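/- Let $K$ be an arbitrary field and let $X^0$ be an infinite set. Let $\mathcal{CA}^\circ$ be the category whose objects are the free commutative-associative unital $K$-algebras $F(X)=K[x \mid x\in X]$ (polynomial algebras) on finite subsets $X\subset X^0$, and whose morphisms are all unital $K$-algebra homomorphisms. Then every automorphism $\varphi$ of the category $\mathcal{CA}^\circ$ (a functor $\varphi:\mathcal{CA}^\circ\to\mathcal{CA}^\circ$ with a two-sided inverse functor $\psi$, i.e. $\psi\varphi=\varphi\psi=1_{\mathcal{CA}^\circ}$) is semi-inner: there exist a field automorphism $\delta$ of $K$ and, for every object $F$ of $\mathcal{CA}^\circ$, a ring isomorphism $s_F:F\to\varphi(F)$ with $$s_F(\alpha u)=\delta(\alpha)\,s_F(u)\qquad\text{for all }\alpha\in K,\ u\in F,$$ such that for every morphism $\nu:F\to G$ of $\mathcal{CA}^\circ$ $$s_G\circ\nu=\varphi(\nu)\circ s_F .$$ -/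

import Mathlib

open CategoryTheory

universe u v

/-- The objects of the category `CA°`: the free commutative-associative algebras with `1` over `K`
on finite subsets `X` of a fixed set `X₀` of variables. The object is recorded by its finite set
of free generators. -/
structure FreeCA (K : Type u) (X₀ : Type v) where
  /-- the finite set of free generators -/
  vars : Finset X₀

namespace FreeCA

/-- The algebra `F(X) = K[x | x ∈ X]`. -/
abbrev alg {K : Type u} [Field K] {X₀ : Type v} (F : FreeCA K X₀) : Type (max u v) :=
  MvPolynomial {x : X₀ // x ∈ F.vars} K

/-- `CA°` is a full subcategory of the category of commutative `K`-algebras with `1`: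
the morphisms `F(X) ⟶ F(Y)` are all (unital) `K`-algebra homomorphisms. -/
noncomputable instance instCategory {K : Type u} [Field K] {X₀ : Type v} : Category (FreeCA K X₀) where
  Hom F G := F.alg →ₐ[K] G.alg
  id F := AlgHom.id K F.alg
  comp f g := AlgHom.comp g f

/-- The algebra homomorphism underlying a morphism of `CA°`. -/
noncomputable def toAlgHom {K : Type u} [Field K] {X₀ : Type v} {F G : FreeCA K X₀} (ν : F ⟶ G) :
    F.alg →ₐ[K] G.alg := ν

end FreeCA

/-- An automorphism of a category `C` is a functor `φ : C ⥤ C` that has a strict two-sided inverse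
functor (equivalently, that is bijective on objects and on morphisms). -/
def IsCategoryAutomorphism {C : Type*} [Category C] (φ : C ⥤ C) : Prop :=
  ∃ ψ : C ⥤ C, φ ⋙ ψ = 𝟭 C ∧ ψ ⋙ φ = 𝟭 C

/-- The pair `(δ, s)`, with `δ` an automorphism of `K` and `s : A → B` a ring isomorphism of
`K`-algebras, is a semi-isomorphism: `s (a • u) = δ a • s u`. -/
def IsSemiIsomorphism {K : Type*} [Field K] {A B : Type*} [CommRing A] [Algebra K A]
    [CommRing B] [Algebra K B] (δ : K ≃+* K) (s : A ≃+* B) : Prop :=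
  ∀ (a : K) (u : A), s (a • u) = δ a • s u

/-- `φ : CA° ⥤ CA°` is semi-inner: there are one automorphism `δ` of `K` and a family of
semi-isomorphisms `(δ, s F) : F → φ F` such that `s G ∘ ν = φ ν ∘ s F` for each `ν : F ⟶ G`. -/
def IsSemiInner {K : Type u} [Field K] {X₀ : Type v} (φ : FreeCA K X₀ ⥤ FreeCA K X₀) : Prop :=
  ∃ (δ : K ≃+* K) (s : ∀ F : FreeCA K X₀, F.alg ≃+* (φ.obj F).alg),
    (∀ F, IsSemiIsomorphism δ (s F)) ∧
    ∀ (F G : FreeCA K X₀) (ν : F ⟶ G) (u : F.alg),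
      s G (FreeCA.toAlgHom ν u) = FreeCA.toAlgHom (φ.map ν) (s F u)

/-! Elements of `F` are morphisms from the line `K[x₀]` to `F`, so `φ` carries them to morphisms `φ
(line) ⟶ φ F`. By `card_vars_line` the image of the line again has a single variable; hence such
morphisms are elements of `φ F`, and `transport` is a natural bijection `F → φ F`. By naturality, it
carries addition, subtraction and multiplication to operations given by universal two-variable
polynomials over `K` (`exists_binary_law`). Ring identities constrain these polynomials: a sum must
become `a + b - c` (`evalPair_eq_add_sub`), and, once translation by `c` sends `0` to `0`, a product
must become `e⁻¹ab` (`evalPair_eq_mul`). Rescaling by `e⁻¹` gives the ring isomorphisms; their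
common action on constants is `δ`. -/

/-! ### Two-variable polynomial laws. -/

section LawPolynomials

open Polynomial

/-- The value at `(a, b)` of a polynomial in two variables: the outer variable is replaced by `a`,
the inner one by `b`. -/
noncomputable def evalPair {K : Type*} [Field K] {R : Type*} [CommRing R] [Algebra K R]
    (P : K[X][X]) (a b : R) : R :=
  P.eval₂ (aeval b : K[X] →ₐ[K] R).toRingHom a

variable {K : Type u} [Field K]

theorem map_evalPair {R S : Type*} [CommRing R] [Algebra K R] [CommRing S]
    [Algebra K S] (f : R →ₐ[K] S) (P : K[X][X]) (a b : R) :
    f (evalPair P a b) = evalPair P (f a) (f b) := by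
  have h := hom_eval₂ P (aeval b : K[X] →ₐ[K] R).toRingHom f.toRingHom a
  have e : f.toRingHom.comp (aeval b : K[X] →ₐ[K] R).toRingHom
      = (aeval (f b) : K[X] →ₐ[K] S).toRingHom := by
    ext x <;> simp
  rw [e] at h
  exact h

theorem evalPair_C_right {R : Type*} [CommRing R] [Algebra K R]
    (P : K[X][X]) (a : R[X]) (b : R) :
    evalPair P a (C b) = (P.map (aeval b : K[X] →ₐ[K] R).toRingHom).comp a := by
  rw [comp, eval₂_map, evalPair]
  congr 1
  ext x
  · simp [Polynomial.algebraMap_apply]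
  · simp

theorem evalPair_C_C {R : Type*} [CommRing R] [Algebra K R] (P : K[X][X]) (a b : R) :
    evalPair P (C a) (C b) = C (evalPair P a b) := by
  rw [evalPair_C_right, comp_C, evalPair, Polynomial.eval_map]

theorem map_aeval_X (P : K[X][X]) : P.map (aeval (X : K[X]) : K[X] →ₐ[K] K[X]).toRingHom = P := by
  convert Polynomial.map_id
  ext x <;> simp

/-- Two variable polynomials `P` (addition) and `M` (subtraction) with `(a + b) - b = a`,
and such that the constant `c` is neutral for `P`, are given by `P = a + b - c`. -/
theorem evalPair_eq_add_sub (P M : K[X][X]) (c : K)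
    (hPM : ∀ (R : Type u) [CommRing R] [Algebra K R] (a b : R),
      evalPair M (evalPair P a b) b = a)
    (hr : ∀ (R : Type u) [CommRing R] [Algebra K R] (a : R), evalPair P a (algebraMap K R c) = a)
    (hl : ∀ (R : Type u) [CommRing R] [Algebra K R] (b : R), evalPair P (algebraMap K R c) b = b)
    (R : Type*) [CommRing R] [Algebra K R] (a b : R) :
    evalPair P a b = a + b - algebraMap K R c := by
  -- Evaluating at two independent variables turns the law into a polynomial identity, so finite `K`
  -- needs no separate treatment.
  have h1 : M.comp P = X := by
    have h := hPM K[X][X] (X : K[X][X]) (C X)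
    rwa [evalPair_C_right, evalPair_C_right, comp_X, map_aeval_X, map_aeval_X] at h
  have hd : M.natDegree * P.natDegree = 1 := by
    rw [← natDegree_comp, h1, natDegree_X]
  have hP : P.natDegree = 1 := Nat.eq_one_of_mul_eq_one_left hd
  have hM : M.natDegree = 1 := Nat.eq_one_of_mul_eq_one_right hd
  obtain ⟨p1, p0, rfl⟩ : ∃ p1 p0 : K[X], P = C p1 * X + C p0 :=
    exists_eq_X_add_C_of_natDegree_le_one hP.le
  obtain ⟨m1, m0, rfl⟩ : ∃ p1 p0 : K[X], M = C p1 * X + C p0 :=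
    exists_eq_X_add_C_of_natDegree_le_one hM.le
  have hu : m1 * p1 = 1 := by
    have h2 := congrArg (fun p => coeff p 1) h1
    simp only [add_comp, mul_comp, C_comp, X_comp] at h2
    simpa [mul_add] using h2
  -- Units of `K[X]` are constants, so the leading coefficient lies in `K`.
  have hu' : IsUnit p1 := IsUnit.of_mul_eq_one_right _ hu
  obtain ⟨α, -, rfl⟩ := Polynomial.isUnit_iff.mp hu'
  have hα : α = 1 := by
    have h0 := hr K 0
    have h2 := hr K 1
    simp [evalPair] at h0 h2
    rw [h0] at h2; simpa using h2
  subst hα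
  have hp0 : p0 = X - C c := by
    have := hl K[X] (X : K[X])
    simp [evalPair] at this
    rw [← this]; ring
  subst hp0
  simp [evalPair]
  ring

/-- A commutative associative two variable polynomial `Q` with a nonzero unit `e`, for which `0`
is absorbing, is `e⁻¹ a b`. -/
theorem evalPair_eq_mul (Q : K[X][X]) (e : K) (he : e ≠ 0)
    (hassoc : ∀ (R : Type u) [CommRing R] [Algebra K R] (a b c : R),
      evalPair Q (evalPair Q a b) c = evalPair Q a (evalPair Q b c))
    (hcomm : ∀ (R : Type u) [CommRing R] [Algebra K R] (a b : R), evalPair Q a b = evalPair Q b a)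
    (hzero : ∀ (R : Type u) [CommRing R] [Algebra K R] (b : R), evalPair Q 0 b = 0)
    (hone : ∀ (R : Type u) [CommRing R] [Algebra K R] (a : R), evalPair Q a (algebraMap K R e) = a)
    (R : Type*) [CommRing R] [Algebra K R] (a b : R) :
    evalPair Q a b = algebraMap K R e⁻¹ * a * b := by
  have hd : Q.natDegree ≤ 1 := by
    -- For three independent variables and `d = Q.natDegree`, the degree in the outermost one is
    -- `d²` on the left and at most `d` on the right.
    have h := hassoc K[X][X][X] (X : K[X][X][X]) (C (C X)) (C X)
    have hi : ∀ b : K[X][X], Function.Injective (aeval b : K[X] →ₐ[K] K[X][X]) →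
        (Q.map (aeval b : K[X] →ₐ[K] K[X][X]).toRingHom).natDegree = Q.natDegree :=
      fun b hb => natDegree_map_eq_of_injective hb Q
    have h3 : evalPair Q (C (C X)) (C X : K[X][X][X]) = C (evalPair Q (C X) (X : K[X][X])) :=
      evalPair_C_C Q _ _
    rw [h3, evalPair_C_right, evalPair_C_right, evalPair_C_right, comp_X, comp_X] at h
    have h4 := congrArg natDegree h
    rw [natDegree_comp, hi, hi] at h4
    · have h5 := natDegree_map_le (p := Q)
        (f := (aeval (evalPair Q (C X) (X : K[X][X])) : K[X] →ₐ[K] K[X][X]).toRingHom)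
      by_contra! h6
      rw [← h4] at h5
      nlinarith
    · have : (aeval (C X : K[X][X]) : K[X] →ₐ[K] K[X][X]).toRingHom = C := by
        ext x <;> simp [Polynomial.algebraMap_apply]
      intro x y hxy
      exact C_injective ((congrFun (congrArg DFunLike.coe this) x).symm.trans
        (hxy.trans (congrFun (congrArg DFunLike.coe this) y)))
    · have : (aeval (X : K[X][X]) : K[X] →ₐ[K] K[X][X]).toRingHom = mapRingHom C := by
        ext x <;> simp [Polynomial.algebraMap_apply]
      intro x y hxy
      exact map_injective C C_injective ((congrFun (congrArg DFunLike.coe this) x).symm.trans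
        (hxy.trans (congrFun (congrArg DFunLike.coe this) y)))
  obtain ⟨p1, p0, rfl⟩ : ∃ p1 p0 : K[X], Q = C p1 * X + C p0 :=
    exists_eq_X_add_C_of_natDegree_le_one hd
  have hp0 : p0 = 0 := by
    simpa [evalPair] using hzero K[X] (X : K[X])
  subst hp0
  have h1 : p1.eval e = 1 := by
    simpa [evalPair] using hone K 1
  have h2 : C e * p1 = X := by
    have h3 := hcomm K[X] (X : K[X]) (C e)
    have h4 := hone K[X] (X : K[X])
    rw [Polynomial.algebraMap_apply, Algebra.algebraMap_self_apply, h3] at h4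
    simp [evalPair] at h4
    rw [mul_comm, h4]
  have hp1 : p1 = C e⁻¹ * X := by
    rw [← h2, ← mul_assoc, ← C_mul, inv_mul_cancel₀ he]; simp
  subst hp1
  simp [evalPair]
  ring

end LawPolynomials

/-! ### Elements as morphisms from the line. -/

namespace FreeCA

/-- The polynomial algebra in the single variable `x₀`. -/
def line (K : Type u) {X₀ : Type v} (x₀ : X₀) : FreeCA K X₀ := ⟨{x₀}⟩

/-- The variable of `line K x₀`. -/
def lineVar (K : Type u) {X₀ : Type v} (x₀ : X₀) : {x : X₀ // x ∈ (line K x₀).vars} :=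
  ⟨x₀, Finset.mem_singleton_self x₀⟩

theorem eq_lineVar {K : Type u} {X₀ : Type v} {x₀ : X₀} (x : {x : X₀ // x ∈ (line K x₀).vars}) : x = lineVar K x₀ :=
  Subtype.ext (Finset.mem_singleton.mp x.2)

variable {K : Type u} [Field K] {X₀ : Type v}

theorem toAlgHom_id_apply (F : FreeCA K X₀) (u : F.alg) : toAlgHom (𝟙 F) u = u := rfl

theorem toAlgHom_comp_apply {F G H : FreeCA K X₀} (f : F ⟶ G) (g : G ⟶ H) (u : F.alg) :
    toAlgHom (f ≫ g) u = toAlgHom g (toAlgHom f u) := rfl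

theorem hom_ext {F G : FreeCA K X₀} {f g : F ⟶ G}
    (h : ∀ x, toAlgHom f (MvPolynomial.X x) = toAlgHom g (MvPolynomial.X x)) : f = g :=
  MvPolynomial.algHom_ext (f := toAlgHom f) (g := toAlgHom g) h

/-- The morphism given by its values on the free generators. -/
noncomputable def homOfVars {F G : FreeCA K X₀} (c : {x : X₀ // x ∈ F.vars} → G.alg) : F ⟶ G :=
  (MvPolynomial.aeval c : F.alg →ₐ[K] G.alg)

@[simp]
theorem toAlgHom_homOfVars_X {F G : FreeCA K X₀} (c : {x : X₀ // x ∈ F.vars} → G.alg) (x) :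
    toAlgHom (homOfVars c) (MvPolynomial.X x) = c x :=
  MvPolynomial.aeval_X _ _

/-- The morphism from the line that sends the variable to `u`. -/
noncomputable def point (x₀ : X₀) {F : FreeCA K X₀} (u : F.alg) : line K x₀ ⟶ F :=
  homOfVars fun _ => u

theorem toAlgHom_point (x₀ : X₀) {F : FreeCA K X₀} (u : F.alg) (x) :
    toAlgHom (point x₀ u) (MvPolynomial.X x) = u :=
  toAlgHom_homOfVars_X _ _

theorem point_comp {x₀ : X₀} {F G : FreeCA K X₀} (u : F.alg) (f : F ⟶ G) :
    point x₀ u ≫ f = point x₀ (toAlgHom f u) :=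
  hom_ext fun x => by rw [toAlgHom_comp_apply, toAlgHom_point, toAlgHom_point]

theorem eq_point {x₀ : X₀} {F : FreeCA K X₀} (f : line K x₀ ⟶ F) :
    f = point x₀ (toAlgHom f (MvPolynomial.X (lineVar K x₀))) :=
  hom_ext fun x => by rw [toAlgHom_point, eq_lineVar x]

/-! ### Effect of `φ` on the number of variables. -/

section Equivalence

variable (φ : FreeCA K X₀ ⥤ FreeCA K X₀) (x₀ : X₀)

/-- The free generators of `φ F` obtained from those of `F` and those of the image of the line. -/
noncomputable def imageGen (F : FreeCA K X₀)
    (i : {x : X₀ // x ∈ F.vars} × {x : X₀ // x ∈ (φ.obj (line K x₀)).vars}) : (φ.obj F).alg :=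
  toAlgHom (φ.map (point x₀ (MvPolynomial.X i.1))) (MvPolynomial.X i.2)

variable {φ} [φ.Full]

/-- Together with `exists_hom_imageGen`, this is the universal property making `φ F` free on the
family `imageGen`. -/
theorem imageGen_hom_ext [φ.Faithful] (hs : Function.Surjective φ.obj) {F G : FreeCA K X₀}
    {f g : φ.obj F ⟶ G}
    (h : ∀ i, toAlgHom f (imageGen φ x₀ F i) = toAlgHom g (imageGen φ x₀ F i)) : f = g := by
  obtain ⟨G, rfl⟩ := hs G
  obtain ⟨f, rfl⟩ := φ.map_surjective f
  obtain ⟨g, rfl⟩ := φ.map_surjective g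
  congr 1
  refine hom_ext fun x => ?_
  have h1 : φ.map (point x₀ (MvPolynomial.X x) ≫ f) = φ.map (point x₀ (MvPolynomial.X x) ≫ g) := by
    refine hom_ext fun a => ?_
    rw [φ.map_comp, φ.map_comp, toAlgHom_comp_apply, toAlgHom_comp_apply]
    exact h (x, a)
  have h2 := φ.map_injective h1
  rw [point_comp, point_comp] at h2
  have h3 := congrArg (fun k => toAlgHom k (MvPolynomial.X (lineVar K x₀))) h2
  simpa only [toAlgHom_point] using h3

theorem exists_hom_imageGen (hs : Function.Surjective φ.obj) {F G : FreeCA K X₀}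
    (c : {x : X₀ // x ∈ F.vars} × {x : X₀ // x ∈ (φ.obj (line K x₀)).vars} → G.alg) :
    ∃ f : φ.obj F ⟶ G, ∀ i, toAlgHom f (imageGen φ x₀ F i) = c i := by
  obtain ⟨G, rfl⟩ := hs G
  choose p hp using fun x => φ.map_surjective
    (homOfVars (F := φ.obj (line K x₀)) (G := φ.obj G) fun a => c (x, a))
  refine ⟨φ.map (homOfVars fun x => toAlgHom (p x) (MvPolynomial.X (lineVar K x₀))), ?_⟩
  rintro ⟨x, a⟩
  rw [imageGen, ← toAlgHom_comp_apply, ← φ.map_comp, point_comp, toAlgHom_homOfVars_X, ← eq_point,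
    hp, toAlgHom_homOfVars_X]

/-- Two free generating families of `φ F` have the same size, by transcendence degree; `X₀` being
infinite supplies enough variables for `D`. -/
theorem card_vars_obj [Infinite X₀] [φ.Faithful] (hs : Function.Surjective φ.obj) (F : FreeCA K X₀) :
    (φ.obj F).vars.card = F.vars.card * (φ.obj (line K x₀)).vars.card := by
  obtain ⟨W, hW⟩ := Infinite.exists_subset_card_eq X₀
    (F.vars.card * (φ.obj (line K x₀)).vars.card)
  let e : {x : X₀ // x ∈ W} ≃
      {x : X₀ // x ∈ F.vars} × {x : X₀ // x ∈ (φ.obj (line K x₀)).vars} :=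
    Fintype.equivOfCardEq (by simp [hW])
  let D : FreeCA K X₀ := ⟨W⟩
  let h : D ⟶ φ.obj F := homOfVars fun w => imageGen φ x₀ F (e w)
  obtain ⟨k, hk⟩ := exists_hom_imageGen x₀ hs (F := F) (G := D)
    fun i => MvPolynomial.X (e.symm i)
  have h1 : k ≫ h = 𝟙 _ := imageGen_hom_ext x₀ hs fun i => by
    rw [toAlgHom_comp_apply, hk, toAlgHom_homOfVars_X, Equiv.apply_symm_apply]; rfl
  have h2 : h ≫ k = 𝟙 _ := hom_ext fun w => by
    rw [toAlgHom_comp_apply, toAlgHom_homOfVars_X, hk, Equiv.symm_apply_apply]; rfl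
  let E : (φ.obj F).alg ≃ₐ[K] D.alg := AlgEquiv.ofAlgHom (toAlgHom k) (toAlgHom h) h2 h1
  have h3 := E.trdeg_eq
  rw [MvPolynomial.trdeg_of_isDomain, MvPolynomial.trdeg_of_isDomain] at h3
  rw [← hW]
  simpa [D] using h3

theorem card_vars_line [Infinite X₀] [φ.Faithful] (hs : Function.Surjective φ.obj) :
    (φ.obj (line K x₀)).vars.card = 1 := by
  -- The line is itself some `φ F`, so the multiplication formula factors `1`.
  obtain ⟨F, hF⟩ := hs (line K x₀)
  have h := card_vars_obj x₀ hs F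
  rw [hF] at h
  exact Nat.eq_one_of_mul_eq_one_left (h.symm.trans (Finset.card_singleton x₀))

theorem vars_obj_empty [Infinite X₀] [φ.Faithful] (hs : Function.Surjective φ.obj) :
    (φ.obj ⟨∅⟩).vars = ∅ := by
  inhabit X₀
  rw [← Finset.card_eq_zero, card_vars_obj default hs]
  simp

end Equivalence

end FreeCA

theorem IsCategoryAutomorphism.surjective_obj {C : Type*} [Category C] {φ : C ⥤ C}
    (hφ : IsCategoryAutomorphism φ) : Function.Surjective φ.obj := by
  obtain ⟨ψ, -, h⟩ := hφ
  exact fun G => ⟨ψ.obj G, Functor.congr_obj h G⟩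

theorem IsCategoryAutomorphism.isEquivalence {C : Type*} [Category C] {φ : C ⥤ C}
    (hφ : IsCategoryAutomorphism φ) : φ.IsEquivalence := by
  obtain ⟨ψ, h₁, h₂⟩ := hφ
  exact (CategoryTheory.Equivalence.mk φ ψ (eqToIso h₁.symm) (eqToIso h₂)).isEquivalence_functor

open Polynomial in
theorem evalPair_aeval {K : Type*} [Field K] {ι : Type*} (e : ι ≃ Fin 2) {R : Type*} [CommRing R]
    [Algebra K R] (w : MvPolynomial ι K) (a b : R) :
    evalPair (MvPolynomial.aeval (fun i => (![X, C X] (e i) : K[X][X])) w) a b =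
      MvPolynomial.aeval (fun i => ![a, b] (e i)) w := by
  have h : (eval₂RingHom (aeval b : K[X] →ₐ[K] R).toRingHom a).comp
      (MvPolynomial.aeval (fun i => (![X, C X] (e i) : K[X][X]))).toRingHom =
      (MvPolynomial.aeval (R := K) (fun i => ![a, b] (e i))).toRingHom := by
    refine MvPolynomial.ringHom_ext (fun r => ?_) fun i => ?_
    · simp [Polynomial.algebraMap_apply]
    · obtain h | h : e i = 0 ∨ e i = 1 := by omega
      all_goals simp [h]
  exact congrFun (congrArg DFunLike.coe h) w

/-! ### The bijection `F → φ F` and the operations it carries over. -/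

namespace FreeCA

variable {K : Type u} [Field K] {X₀ : Type v} (φ : FreeCA K X₀ ⥤ FreeCA K X₀) {x₀ : X₀}

/-- The map `F → φ F` that sends `u`, seen as a morphism from the line, to the value of its image
at the variable `a` translated by `c`. -/
noncomputable def transport (a : {x : X₀ // x ∈ (φ.obj (line K x₀)).vars}) (c : K)
    (F : FreeCA K X₀) (u : F.alg) : (φ.obj F).alg :=
  toAlgHom (φ.map (point x₀ u)) (MvPolynomial.X a) - algebraMap K _ c

variable {φ} {a : {x : X₀ // x ∈ (φ.obj (line K x₀)).vars}} {c : K}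

theorem transport_eq_sub (F : FreeCA K X₀) (u : F.alg) :
    transport φ a c F u = transport φ a 0 F u - algebraMap K _ c := by
  simp [transport]

theorem map_transport {F G : FreeCA K X₀} (f : F ⟶ G) (u : F.alg) :
    toAlgHom (φ.map f) (transport φ a c F u) = transport φ a c G (toAlgHom f u) := by
  rw [transport, transport, map_sub, AlgHom.commutes, ← toAlgHom_comp_apply, ← φ.map_comp,
    point_comp]

theorem transport_injective [φ.Faithful] (ha : ∀ b, b = a)
    (F : FreeCA K X₀) :
    Function.Injective (transport φ a c F) := by
  intro u v h
  have h1 : φ.map (point x₀ u) = φ.map (point x₀ v) := hom_ext fun b => by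
    rw [ha b]; exact sub_left_injective h
  have h2 := congrArg (fun k => toAlgHom k (MvPolynomial.X (lineVar K x₀))) (φ.map_injective h1)
  simpa only [toAlgHom_point] using h2

theorem transport_surjective [φ.Full] (F : FreeCA K X₀) :
    Function.Surjective (transport φ a c F) := by
  intro w
  obtain ⟨f, hf⟩ := φ.map_surjective
    (homOfVars (F := φ.obj (line K x₀)) (G := φ.obj F) fun _ => w + algebraMap K _ c)
  refine ⟨toAlgHom f (MvPolynomial.X (lineVar K x₀)), ?_⟩
  rw [transport, ← eq_point, hf, toAlgHom_homOfVars_X, add_sub_cancel_right]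

/-- Every operation given by a polynomial `w` in two variables is carried by `transport` to an
operation given by a polynomial in two variables. -/
theorem exists_evalPair_eq_transport [φ.Full] [φ.Faithful] (ha : ∀ b, b = a)
    (hs : Function.Surjective φ.obj)
    {D : FreeCA K X₀} (e : {x : X₀ // x ∈ D.vars} ≃ Fin 2) (w : D.alg) (c : K) :
    ∃ P : Polynomial (Polynomial K), ∀ (F : FreeCA K X₀) (f : D ⟶ F),
      transport φ a c F (toAlgHom f w) =
        evalPair P (transport φ a c F (toAlgHom f (MvPolynomial.X (e.symm 0))))
          (transport φ a c F (toAlgHom f (MvPolynomial.X (e.symm 1)))) := by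
  have hgen : ∀ x b, imageGen φ x₀ D (x, b) =
      transport φ a c D (MvPolynomial.X x) + algebraMap K _ c := fun x b => by
    rw [transport, sub_add_cancel, ha b, imageGen]
  let h : D ⟶ φ.obj D := homOfVars fun x => transport φ a c D (MvPolynomial.X x)
  -- The shift by `c` undoes the translation in `transport`. Since `g ≫ h = 𝟙`, the transport of `w`
  -- is a polynomial in the transported variables.
  obtain ⟨g, hg⟩ := exists_hom_imageGen x₀ hs (F := D) (G := D)
    fun i => MvPolynomial.X i.1 + algebraMap K _ c
  have hgh : g ≫ h = 𝟙 _ := imageGen_hom_ext x₀ hs fun i => by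
    rw [toAlgHom_comp_apply, hg, map_add, toAlgHom_homOfVars_X, AlgHom.commutes,
      toAlgHom_id_apply, ← hgen _ i.2]
  refine ⟨MvPolynomial.aeval (fun i => ![Polynomial.X, Polynomial.C Polynomial.X] (e i))
    (toAlgHom g (transport φ a c D w)), fun F f => ?_⟩
  rw [evalPair_aeval]
  have h1 : transport φ a c F (toAlgHom f w) =
      toAlgHom (h ≫ φ.map f) (toAlgHom g (transport φ a c D w)) := by
    rw [← toAlgHom_comp_apply, ← Category.assoc, hgh, Category.id_comp, map_transport]
  rw [h1]
  refine congrFun (congrArg DFunLike.coe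
    (MvPolynomial.algHom_ext (f := toAlgHom (h ≫ φ.map f)) fun i => ?_)) _
  rw [toAlgHom_comp_apply, toAlgHom_homOfVars_X, map_transport, MvPolynomial.aeval_X]
  obtain ⟨j, rfl⟩ := e.symm.surjective i
  obtain rfl | rfl : j = 0 ∨ j = 1 := by omega
  all_goals simp

theorem exists_binary_law [Infinite X₀] [φ.Full] [φ.Faithful] (ha : ∀ b, b = a)
    (hs : Function.Surjective φ.obj)
    (c : K) (w : MvPolynomial (Fin 2) K) :
    ∃ P : Polynomial (Polynomial K), ∀ (F : FreeCA K X₀) (u v : F.alg),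
      transport φ a c F (MvPolynomial.aeval ![u, v] w) =
        evalPair P (transport φ a c F u) (transport φ a c F v) := by
  obtain ⟨W, hW⟩ := Infinite.exists_subset_card_eq X₀ 2
  let e : {x : X₀ // x ∈ W} ≃ Fin 2 := Fintype.equivOfCardEq (by simp [hW])
  obtain ⟨P, hP⟩ := exists_evalPair_eq_transport ha hs (D := ⟨W⟩) e
    (MvPolynomial.rename e.symm w) c
  refine ⟨P, fun F u v => ?_⟩
  have h := hP F (homOfVars fun x => ![u, v] (e x))
  rw [toAlgHom_homOfVars_X, toAlgHom_homOfVars_X, Equiv.apply_symm_apply,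
    Equiv.apply_symm_apply] at h
  refine Eq.trans (congrArg _ ?_) h
  refine Eq.trans ?_ (MvPolynomial.aeval_rename e.symm _ w).symm
  congr 2
  ext i
  simp

/-- Any three elements of a commutative algebra are the images of transported elements. -/
theorem exists_hom_transport_eq [Infinite X₀] [φ.Full]
    (hs : Function.Surjective φ.obj)
    (c : K) {R : Type*} [CommRing R] [Algebra K R] (r₁ r₂ r₃ : R) :
    ∃ (F : FreeCA K X₀) (u v w : F.alg) (f : (φ.obj F).alg →ₐ[K] R),
      f (transport φ a c F u) = r₁ ∧ f (transport φ a c F v) = r₂ ∧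
        f (transport φ a c F w) = r₃ := by
  obtain ⟨W, hW⟩ := Infinite.exists_subset_card_eq X₀ 3
  let e : {x : X₀ // x ∈ W} ≃ Fin 3 := Fintype.equivOfCardEq (by simp [hW])
  obtain ⟨F, hF⟩ := hs ⟨W⟩
  have h : ∃ (x y z : (φ.obj F).alg) (f : (φ.obj F).alg →ₐ[K] R),
      f x = r₁ ∧ f y = r₂ ∧ f z = r₃ := by
    rw [hF]
    exact ⟨MvPolynomial.X (e.symm 0), MvPolynomial.X (e.symm 1), MvPolynomial.X (e.symm 2),
      MvPolynomial.aeval fun x => ![r₁, r₂, r₃] (e x), by simp, by simp, by simp⟩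
  obtain ⟨x, y, z, f, hx, hy, hz⟩ := h
  obtain ⟨u, rfl⟩ := transport_surjective (a := a) (c := c) F x
  obtain ⟨v, rfl⟩ := transport_surjective (a := a) (c := c) F y
  obtain ⟨w, rfl⟩ := transport_surjective (a := a) (c := c) F z
  exact ⟨F, u, v, w, f, hx, hy, hz⟩

/-- Constants come from the object without variables, which is `K` and whose image again has no
variables; naturality makes `d` independent of `F`. -/
theorem exists_transport_algebraMap [Infinite X₀] [φ.Full] [φ.Faithful]
    (hs : Function.Surjective φ.obj) :
    ∃ d : K → K, ∀ (F : FreeCA K X₀) (α : K),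
      transport φ a c F (algebraMap K _ α) = algebraMap K _ (d α) := by
  have hE : IsEmpty {x : X₀ // x ∈ (φ.obj (⟨∅⟩ : FreeCA K X₀)).vars} := by
    rw [vars_obj_empty hs]
    exact ⟨fun x => Finset.notMem_empty x.1 x.2⟩
  choose d hd using fun α => MvPolynomial.C_surjective (R := K)
    {x : X₀ // x ∈ (φ.obj (⟨∅⟩ : FreeCA K X₀)).vars}
    (transport φ a c ⟨∅⟩ (algebraMap K (alg ⟨∅⟩) α))
  refine ⟨d, fun F α => ?_⟩
  let f : (⟨∅⟩ : FreeCA K X₀) ⟶ F := homOfVars fun _ => 0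
  rw [← AlgHom.commutes (toAlgHom f), ← map_transport, ← hd,
    ← AlgHom.commutes (toAlgHom (φ.map f))]
  rfl

theorem transport_add [Infinite X₀] [φ.Full] [φ.Faithful] (ha : ∀ b, b = a)
    (hs : Function.Surjective φ.obj)
    {c : K} (hc : ∀ F : FreeCA K X₀, transport φ a 0 F 0 = algebraMap K _ c)
    (F : FreeCA K X₀) (u v : F.alg) :
    transport φ a c F (u + v) = transport φ a c F u + transport φ a c F v := by
  -- The law is found for the untranslated bijection, where it is `a + b - c`; translating by `c`
  -- makes it additive.
  obtain ⟨P, hP⟩ := exists_binary_law ha hs 0 (MvPolynomial.X 0 + MvPolynomial.X 1)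
  obtain ⟨M, hM⟩ := exists_binary_law ha hs 0 (MvPolynomial.X 0 - MvPolynomial.X 1)
  simp only [map_add, map_sub, MvPolynomial.aeval_X, Matrix.cons_val_zero,
    Matrix.cons_val_one] at hP hM
  have h := evalPair_eq_add_sub P M c ?_ ?_ ?_ (φ.obj F).alg (transport φ a 0 F u)
    (transport φ a 0 F v)
  · rw [transport_eq_sub, transport_eq_sub F u, transport_eq_sub F v, hP, h]
    ring
  · intro R _ _ x y
    obtain ⟨F, u, v, -, f, rfl, rfl, -⟩ := exists_hom_transport_eq (a := a) hs 0 x y 0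
    rw [← map_evalPair, ← hP, ← map_evalPair, ← hM, add_sub_cancel_right]
  · intro R _ _ x
    obtain ⟨F, u, -, -, f, rfl, -⟩ := exists_hom_transport_eq (a := a) hs 0 x 0 0
    rw [← f.commutes, ← hc, ← map_evalPair, ← hP, add_zero]
  · intro R _ _ x
    obtain ⟨F, u, -, -, f, rfl, -⟩ := exists_hom_transport_eq (a := a) hs 0 x 0 0
    rw [← f.commutes, ← hc, ← map_evalPair, ← hP, zero_add]

theorem transport_mul [Infinite X₀] [φ.Full] [φ.Faithful] (ha : ∀ b, b = a)
    (hs : Function.Surjective φ.obj)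
    {c e : K} (he : e ≠ 0) (h0 : ∀ F : FreeCA K X₀, transport φ a c F 0 = 0)
    (h1 : ∀ F : FreeCA K X₀, transport φ a c F 1 = algebraMap K _ e)
    (F : FreeCA K X₀) (u v : F.alg) :
    transport φ a c F (u * v) =
      algebraMap K _ e⁻¹ * transport φ a c F u * transport φ a c F v := by
  obtain ⟨Q, hQ⟩ := exists_binary_law ha hs c (MvPolynomial.X 0 * MvPolynomial.X 1)
  simp only [map_mul, MvPolynomial.aeval_X, Matrix.cons_val_zero, Matrix.cons_val_one] at hQ
  rw [hQ]
  apply evalPair_eq_mul Q e he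
  · intro R _ _ x y z
    obtain ⟨F, u, v, w, f, rfl, rfl, rfl⟩ := exists_hom_transport_eq (a := a) hs c x y z
    simp only [← map_evalPair, ← hQ, mul_assoc]
  · intro R _ _ x y
    obtain ⟨F, u, v, -, f, rfl, rfl, -⟩ := exists_hom_transport_eq (a := a) hs c x y 0
    simp only [← map_evalPair, ← hQ, mul_comm]
  · intro R _ _ x
    obtain ⟨F, u, -, -, f, rfl, -⟩ := exists_hom_transport_eq (a := a) hs c x 0 0
    rw [← map_zero f, ← h0, ← map_evalPair, ← hQ, zero_mul, h0]
  · intro R _ _ x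
    obtain ⟨F, u, -, -, f, rfl, -⟩ := exists_hom_transport_eq (a := a) hs c x 0 0
    rw [← f.commutes, ← h1, ← map_evalPair, ← hQ, mul_one]

end FreeCA

/-! ### Normalization and assembly. -/

open FreeCA in
theorem theorem4p3 {K : Type u} [Field K] {X₀ : Type v} [Infinite X₀]
    (φ : FreeCA K X₀ ⥤ FreeCA K X₀) (hφ : IsCategoryAutomorphism φ) :
    IsSemiInner φ := by
  have hs := hφ.surjective_obj
  have := hφ.isEquivalence
  inhabit X₀
  let x₀ : X₀ := default
  obtain ⟨a, ha⟩ : ∃ a : {x : X₀ // x ∈ (φ.obj (line K x₀)).vars}, ∀ b, b = a := by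
    obtain ⟨a, h⟩ := Finset.card_eq_one.mp (card_vars_line x₀ hs)
    exact ⟨⟨a, by simp [h]⟩, fun b => Subtype.ext (by simpa [h] using b.2)⟩
  obtain ⟨d₀, hd₀⟩ := exists_transport_algebraMap (a := a) (c := 0) hs
  let c := d₀ 0
  have hc : ∀ F : FreeCA K X₀, transport φ a 0 F 0 = algebraMap K _ c := fun F => by
    rw [← hd₀, map_zero]
  obtain ⟨d, hd⟩ := exists_transport_algebraMap (a := a) (c := c) hs
  have h0 : ∀ F : FreeCA K X₀, transport φ a c F 0 = 0 := fun F => by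
    rw [transport_eq_sub, hc, sub_self]
  let e := d 1
  have h1 : ∀ F : FreeCA K X₀, transport φ a c F 1 = algebraMap K _ e := fun F => by
    rw [← hd, map_one]
  -- Otherwise `0` and `1` would have the same transport.
  have he : e ≠ 0 := fun h => one_ne_zero <| transport_injective ha (line K x₀)
    ((h1 _).trans (((congrArg _ h).trans (map_zero _)).trans (h0 _).symm))
  have hu : ∀ F : FreeCA K X₀, algebraMap K F.alg e⁻¹ * algebraMap K F.alg e = 1 := fun F => by
    rw [← map_mul, inv_mul_cancel₀ he, map_one]
  -- The factor `e⁻¹` turns the product law `e⁻¹ab` into `ab` and preserves additivity.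
  let s : ∀ F : FreeCA K X₀, F.alg ≃+* (φ.obj F).alg := fun F =>
    { Equiv.ofBijective (fun u => algebraMap K _ e⁻¹ * transport φ a c F u)
        ⟨(IsUnit.of_mul_eq_one _ (hu _)).mul_right_injective.comp (transport_injective ha F),
          fun w => (transport_surjective (a := a) (c := c) F (algebraMap K _ e * w)).imp fun u h => by
            simp only [h, ← mul_assoc, hu, one_mul]⟩ with
      map_mul' := fun u v => by
        change algebraMap K _ e⁻¹ * _ = (algebraMap K _ e⁻¹ * _) * (algebraMap K _ e⁻¹ * _)
        rw [transport_mul ha hs he h0 h1]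
        ring
      map_add' := fun u v => by
        change algebraMap K _ e⁻¹ * _ = (algebraMap K _ e⁻¹ * _) + (algebraMap K _ e⁻¹ * _)
        rw [transport_add ha hs hc]
        ring }
  have hsF : ∀ F u, s F u = algebraMap K _ e⁻¹ * transport φ a c F u := fun F u => rfl
  have hsC : ∀ (F : FreeCA K X₀) (α : K), s F (algebraMap K _ α) = algebraMap K _ (e⁻¹ * d α) :=
    fun F α => by rw [hsF, hd, map_mul]
  have hinj : ∀ F : FreeCA K X₀, Function.Injective (algebraMap K F.alg) :=
    fun F => FaithfulSMul.algebraMap_injective K F.alg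
  let O : FreeCA K X₀ := ⟨∅⟩
  let δ₀ : K →+* K :=
    { toFun := fun α => e⁻¹ * d α
      map_one' := hinj (φ.obj O) (by rw [← hsC]; simp)
      map_zero' := hinj (φ.obj O) (by rw [← hsC]; simp)
      map_mul' := fun α β => hinj (φ.obj O) (by
        rw [← hsC, map_mul, map_mul, hsC, hsC, ← map_mul])
      map_add' := fun α β => hinj (φ.obj O) (by
        rw [← hsC, map_add, map_add, hsC, hsC, ← map_add]) }
  -- Every element of `O.alg` is a constant, so surjectivity of `s O` passes to `δ₀`.
  have hδ : Function.Surjective δ₀ := fun β => by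
    obtain ⟨u, hu⟩ := (s O).surjective (algebraMap K _ β)
    have : IsEmpty {x : X₀ // x ∈ O.vars} := ⟨fun x => Finset.notMem_empty x.1 x.2⟩
    obtain ⟨α, rfl⟩ := MvPolynomial.C_surjective (R := K) {x : X₀ // x ∈ O.vars} u
    exact ⟨α, hinj (φ.obj O) ((hsC O α).symm.trans hu)⟩
  refine ⟨RingEquiv.ofBijective δ₀ ⟨δ₀.injective, hδ⟩, s, fun F α u => ?_, fun F G ν u => ?_⟩
  · rw [Algebra.smul_def, map_mul, hsC, Algebra.smul_def]
    rfl
  · rw [hsF, hsF, map_mul, AlgHom.commutes, map_transport]
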